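/- Let $r\ge 1$ be an integer, $p>0$, $\kappa<0$, $p_i:=p+(i-1)\kappa$ for $1\le i\le r+2$, and assume $p_{r+2}\in[0,1)$. Let $\delta_l(z)=(l^{p_1}z_1,\dots,l^{p_r}z_r)$ for $l>0$, let $J_r$ be the $r\times r$ Jordan block (ones on the superdiagonal, zeros elsewhere) and $e_r$ the last canonical basis vector. Let $u_0:\mathbb R^r\to\mathbb R$ be a locally bounded feedback (for instance a continuous one) such that $f_0(z)=J_rz+u_0(z)e_r$ is homogeneous of degree $\kappa$, i.e. $f_0(\delta_l z)=l^{\kappa}\delta_l f_0(z)$, and let $V_1:\mathbb R^r\to\mathbb R_+$ be continuous, positive definite, $C^1$ except at the origin and homogeneous of some degree $d$, i.e. $V_1(\delta_l z)=l^dV_1(z)$. Assume that for some $c>0$, $\alpha\in(0,1)$ one has, for every $z\ne0$: $\nabla V_1(z)\cdot f_0(z)\le -cV_1(z)^{\alpha}$; $u_0(z)\,\partial_rV_1(z)\le 0$; and $\partial_rV_1(z)=0$ whenever $u_0(z)=0$. Let $g:\mathbb R_+\to(0,\infty)$ be increasing and $C^1$ with $g(x)\to+\infty$ as $x\to+\infty$,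 and let $k,\varepsilon>0$, $\bar\varphi>0$, $0<\gamma_m\le\gamma_M$. Consider the closed-loop system $$\dot z\in J_rz+\big(\varphi(t)+\gamma(t)u\big)e_r,\qquad u\in g(|u_0(z)|)u_0(z)+k\,\mathrm{sgn}(u_0(z))\,\hat\varphi_\varepsilon(t,V_1(z)),$$ where $\varphi,\gamma$ are measurable with $|\varphi(t)|\le\bar\varphi$ and $\gamma_m\le\gamma(t)\le\gamma_M$ for a.e. $t\ge0$, $\mathrm{sgn}$ is the multivalued sign ($\mathrm{sgn}(0)=[-1,1]$), and $\hat\varphi_\varepsilon(t,x)=\min\big(t,\tfrac{\varepsilon}{\varepsilon-x}\big)$ if $0\le x<\varepsilon$, $\hat\varphi_\varepsilon(t,x)=t$ if $x\ge\varepsilon$. Trajectories are locally absolutely continuous functions on $[0,\infty)$ that satisfy this inclusion for a.e. $t\geq 0$, the set of values of $u$ being replaced, for each $t$, by the closed convex hull of its limit values as $z$ is approached from all directions (Filippov's convexification, without discarding null sets). Put $$h_m=\min\Big(0,\min_{x\ge0}(\gamma_mg(x)-1)x\Big),\qquad \bar\Phi=\frac{\bar\varphi-h_m}{k\gamma_m}.$$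 For a trajectory $z(\cdot)$ with $z(0)=z_0$, let $T_{z_0}\in[0,\infty]$ be the time needed to reach $\{V_1<\varepsilon\}$ and stay inside, i.e. the infimum of the $T\ge0$ such that $V_1(z(t))<\varepsilon$ for all $t\ge T$. Consider, for $C_1>0$, $$\text{(I)}\quad \frac{d}{dt}V_1(z(t))\le -cV_1(z(t))^{\alpha}+C_1V_1(z(t))^{p_{r+2}}\quad\text{for a.e. }t\ge0\text{ with }z(t)\ne0,$$ $$\text{(II)}\quad T_{z_0}\le\bar\Phi+\frac{\Big(V_1(z_0)^{1-p_{r+2}}+(1-p_{r+2})C_1\bar\Phi\Big)^{\frac{1-\alpha}{1-p_{r+2}}}}{c(1-\alpha)}.$$ 1. For every $C_1>0$, every admissible $(\varphi,\gamma)$ and every trajectory along which (I) holds, (II) holds. 2. If the degree of $V_1$ satisfies $d(1-p_{r+2})=p_r$, there is a constant $C_1>0$, independent of $(\varphi,\gamma)$ and of the trajectory, such that (I) holds along every trajectory (so that (II) holds with this $C_1$ for every trajectory). 3. Whatever the degree $d$, there is a constant $C_1>0$, independent of $(\varphi,\gamma)$ and of the trajectory, such that (II) holds for every trajectory. -/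

import Mathlib

open Set Filter MeasureTheory
open scoped ENNReal NNReal Topology Matrix

noncomputable section

/-- The weights `p_i = p + (i - 1) κ`, `i = 1, 2, …`. -/
def weight (p κ : ℝ) (i : ℕ) : ℝ := p + ((i : ℝ) - 1) * κ

/-- The dilation `z ↦ (l ^ p_1 * z_1, …, l ^ p_r * z_r)`; the entry `i : Fin r` is the
coordinate number `i + 1`. -/
def dilation {r : ℕ} (p κ l : ℝ) (z : Fin r → ℝ) : Fin r → ℝ :=
  fun i => l ^ weight p κ (i.val + 1) * z i

/-- The `r`-th Jordan block: ones just above the diagonal, zeros elsewhere. -/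
def jordanBlock (r : ℕ) : Matrix (Fin r) (Fin r) ℝ :=
  Matrix.of fun i j => if j.val = i.val + 1 then 1 else 0

/-- The last vector `e_r` of the canonical basis. -/
def lastVec (r : ℕ) : Fin r → ℝ := fun i => if i.val + 1 = r then 1 else 0

/-- The velocity `J_r z + s e_r` of the chain of integrators at `z` when the input of the last
integrator is `s`. -/
def chainField {r : ℕ} (z : Fin r → ℝ) (s : ℝ) : Fin r → ℝ :=
  jordanBlock r *ᵥ z + s • lastVec r

/-- The partial derivative of `V` in the direction of the last coordinate. -/
def partialLast {r : ℕ} (V : (Fin r → ℝ) → ℝ) (z : Fin r → ℝ) : ℝ :=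
  fderiv ℝ V z (lastVec r)

/-- The multivalued sign: `x / |x|` for `x ≠ 0` and the interval `[-1, 1]` at `0`. -/
def sgnSet (x : ℝ) : Set ℝ := if x = 0 then Icc (-1) 1 else {x / |x|}

/-- The feedback `u₀` and the Lyapunov function `V` form an admissible pair for the chain of
integrators of length `r` with homogeneity parameters `p`, `κ`; here `d` is the degree of `V` and
`c`, `α` are the constants of the decay estimate. Finite-time stability of the nominal closed loop
is a consequence of the estimate and is not required separately. -/
structure IsHomogeneousPair {r : ℕ} (p κ : ℝ) (u₀ V : (Fin r → ℝ) → ℝ) (d c α : ℝ) : Prop where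
  /-- `u₀` is bounded on bounded sets (for instance continuous). -/
  locallyBounded : ∀ R : ℝ, ∃ M : ℝ, ∀ z : Fin r → ℝ, ‖z‖ ≤ R → |u₀ z| ≤ M
  /-- The nominal closed-loop field is homogeneous of degree `κ`; the last coordinate of this
  identity is the homogeneity of `u₀`. -/
  field_homogeneous : ∀ l : ℝ, 0 < l → ∀ z : Fin r → ℝ,
    chainField (dilation p κ l z) (u₀ (dilation p κ l z))
      = l ^ κ • dilation p κ l (chainField z (u₀ z))
  continuous_V : Continuous V
  V_zero : V 0 = 0
  V_pos : ∀ z : Fin r → ℝ, z ≠ 0 → 0 < V z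
  contDiffOn_V : ContDiffOn ℝ 1 V {0}ᶜ
  V_homogeneous : ∀ l : ℝ, 0 < l → ∀ z : Fin r → ℝ, V (dilation p κ l z) = l ^ d * V z
  c_pos : 0 < c
  α_mem : α ∈ Ioo (0 : ℝ) 1
  /-- The derivative of `V` along nontrivial trajectories of `ż = J_r z + u₀(z) e_r` is at most
  `-c V ^ α`. -/
  decay : ∀ z : Fin r → ℝ, z ≠ 0 → fderiv ℝ V z (chainField z (u₀ z)) ≤ -c * V z ^ α
  sign_nonpos : ∀ z : Fin r → ℝ, z ≠ 0 → u₀ z * partialLast V z ≤ 0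
  partial_eq_zero : ∀ z : Fin r → ℝ, z ≠ 0 → u₀ z = 0 → partialLast V z = 0

/-- The conditions on the gain function `g : [0, ∞) → (0, ∞)`: increasing, `C¹`, unbounded. -/
structure IsGainFunction (g : ℝ → ℝ) : Prop where
  pos : ∀ x : ℝ, 0 ≤ x → 0 < g x
  mono : MonotoneOn g (Ici 0)
  contDiffOn : ContDiffOn ℝ 1 g (Ici 0)
  tendsto : Tendsto g atTop atTop

/-- The adaptive function: `min t (ε / (ε - x))` for `x < ε` and `t` for `x ≥ ε`. -/
def adaptiveGain (ε t x : ℝ) : ℝ := if x < ε then min t (ε / (ε - x)) else t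

/-- The values at `(z, t)` of the multivalued feedback
`g(|u₀(z)|) u₀(z) + k sgn(u₀(z)) φ_ε(t, V(z))`, with `φ_ε` the adaptive function. -/
def controlSet {r : ℕ} (u₀ V : (Fin r → ℝ) → ℝ) (g : ℝ → ℝ) (k ε t : ℝ) (z : Fin r → ℝ) :
    Set ℝ :=
  {u | ∃ s ∈ sgnSet (u₀ z), u = g |u₀ z| * u₀ z + k * s * adaptiveGain ε t (V z)}

/-- The convexified feedback: closed convex hull of the values of the feedback obtained by
approaching `z` in all directions. No null set is discarded, so this contains Filippov's set as
well as `controlSet` itself; for `t ≥ 0` and continuous `u₀` it is equal to `controlSet`. -/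
def filippovControl {r : ℕ} (u₀ V : (Fin r → ℝ) → ℝ) (g : ℝ → ℝ) (k ε t : ℝ) (z : Fin r → ℝ) :
    Set ℝ :=
  ⋂ (δ : ℝ) (_ : 0 < δ),
    closure (convexHull ℝ (⋃ y ∈ Metric.ball z δ, controlSet u₀ V g k ε t y))

/-- The admissible uncertainties `φ`, `γ` on `[0, ∞)` with bounds `φb`, `γm`, `γM`. -/
structure IsUncertainty (φb γm γM : ℝ) (φ γ : ℝ → ℝ) : Prop where
  aemeasurable_φ : AEMeasurable φ (volume.restrict (Ici 0))
  aemeasurable_γ : AEMeasurable γ (volume.restrict (Ici 0))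
  bound_φ : ∀ᵐ t ∂(volume.restrict (Ici (0 : ℝ))), |φ t| ≤ φb
  bound_γ : ∀ᵐ t ∂(volume.restrict (Ici (0 : ℝ))), γm ≤ γ t ∧ γ t ≤ γM

/-- `z` is a trajectory on `[0, ∞)` of the closed-loop system: it is locally absolutely continuous
and `ż ∈ J_r z + (φ(t) + γ(t) u) e_r` for almost every `t ≥ 0`, with `u` in the convexified
feedback. -/
structure IsTrajectory {r : ℕ} (u₀ V : (Fin r → ℝ) → ℝ) (g : ℝ → ℝ) (k ε : ℝ) (φ γ : ℝ → ℝ)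
    (z : ℝ → Fin r → ℝ) : Prop where
  absolutelyContinuous : ∀ T : ℝ, 0 ≤ T → AbsolutelyContinuousOnInterval z 0 T
  inclusion : ∀ᵐ t ∂(volume.restrict (Ici (0 : ℝ))),
    ∃ u ∈ filippovControl u₀ V g k ε t (z t), HasDerivAt z (chainField (z t) (φ t + γ t * u)) t

/-- `h_m = min (0, min_{x ≥ 0} (γm g(x) - 1) x)`. -/
def hMin (g : ℝ → ℝ) (γm : ℝ) : ℝ :=
  min 0 (sInf ((fun x : ℝ => (γm * g x - 1) * x) '' Ici 0))

/-- `Φ = (φb - h_m) / (k γm)`. -/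
def PhiBar (g : ℝ → ℝ) (k φb γm : ℝ) : ℝ := 1 / (k * γm) * (φb - hMin g γm)

/-- The differential inequality `d/dt V(z(t)) ≤ -c V ^ α + C₁ V ^ q` for almost every `t ≥ 0` with
`z(t) ≠ 0` (`V` need not be differentiable at the origin). -/
def DiffIneqAlong {r : ℕ} (V : (Fin r → ℝ) → ℝ) (c α C₁ q : ℝ) (z : ℝ → Fin r → ℝ) : Prop :=
  ∀ᵐ t ∂(volume.restrict (Ici (0 : ℝ))), z t ≠ 0 →
    ∃ v : ℝ, HasDerivAt (fun s => V (z s)) v t ∧ v ≤ -c * V (z t) ^ α + C₁ * V (z t) ^ q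

/-- The time needed to enter `{V < ε}` and stay inside: the infimum of the times `T ≥ 0` such that
`V(z(t)) < ε` for all `t ≥ T`, equal to `∞` if there is none. -/
def convergenceTime {r : ℕ} (V : (Fin r → ℝ) → ℝ) (ε : ℝ) (z : ℝ → Fin r → ℝ) : ℝ≥0∞ :=
  ⨅ (T : ℝ≥0) (_ : ∀ t : ℝ, (T : ℝ) ≤ t → V (z t) < ε), (T : ℝ≥0∞)

/-- `Φ + (v ^ (1 - q) + (1 - q) C₁ Φ) ^ ((1 - α) / (1 - q)) / (c (1 - α))`. -/
def timeBound (Φ v q C₁ c α : ℝ) : ℝ :=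
  Φ + (v ^ (1 - q) + (1 - q) * C₁ * Φ) ^ ((1 - α) / (1 - q)) / (c * (1 - α))

end

/-!
The derivative of `V` along a trajectory is estimated first for values of the feedback that are not
yet convexified. There `φ + γ u` differs from the nominal input `u₀` by a term whose robust part has
the sign of `u₀`, opposite to that of `∂_r V`, so that
`dV/dt ≤ -c V ^ α + |∂_r V| (φb - h_m - k γ_m φ_ε(t, V))`
(`fderiv_chainField_le_of_mem_controlSet`). For a fixed state this is a closed half-line condition
on the input and its right-hand side is continuous in the state, hence it passes to the convexified
feedback even if `u₀` is discontinuous (`fderiv_chainField_le_of_mem_filippovControl`).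

From the time `Φ` on, `φ_ε ≥ Φ` on a neighbourhood of `{V ≥ ε}` and the last term is nonpositive
there. Therefore `{V < ε}` is forward invariant, and `V ^ (1 - α)` decreases at rate `c (1 - α)` as
long as `V ≥ ε` (`IsTrajectory.lt_of_lt_of_le`, `IsTrajectory.convergenceTime_le`). Before `Φ`, an
inequality `dV/dt ≤ C V ^ (1 - s)` bounds the growth of `V ^ s` linearly
(`IsTrajectory.rpow_PhiBar_le`). With `s = 1 - p_{r+2}` the two phases give the time bound.

By homogeneity and compactness of the unit sphere, `|∂_r V| ≤ C V ^ (1 - p_r / d)`, which is the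
differential inequality with `s = p_r / d`; this `s` is `1 - p_{r+2}` for the matching degree.
Whatever the degree, the homogeneity of the decay estimate forces `d (1 - α) = -κ`, so that
`1 - α < p_r / d`. The growth of `V ^ (1 - α)` up to the time `Φ` then tends to `0` as `V(z(0))`
grows, and is absorbed by the slack `ε ^ (1 - α)`, since `V` only has to come down to `ε`. A large
constant `C₁` takes care of bounded `V(z(0))` (`exists_rpow_add_lt`).
-/

/-! ### Differential inequalities along absolutely continuous curves -/

/-- A Lipschitz function composed with an absolutely continuous curve is absolutely continuous. -/
theorem LipschitzOnWith.comp_absolutelyContinuousOnInterval {X Y : Type*}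
    [PseudoMetricSpace X] [PseudoMetricSpace Y] {F : X → Y} {K : ℝ≥0} {S : Set X} {z : ℝ → X}
    {a b : ℝ} (hF : LipschitzOnWith K F S) (hz : AbsolutelyContinuousOnInterval z a b)
    (hS : MapsTo z (uIcc a b) S) : AbsolutelyContinuousOnInterval (fun t => F (z t)) a b := by
  rw [absolutelyContinuousOnInterval_iff] at hz ⊢
  intro ε hε
  obtain ⟨δ, hδ, h⟩ := hz (ε / (K + 1)) (by positivity)
  refine ⟨δ, hδ, fun E hE hlen => ?_⟩
  calc ∑ i ∈ Finset.range E.1, dist (F (z (E.2 i).1)) (F (z (E.2 i).2))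
      ≤ ∑ i ∈ Finset.range E.1, K * dist (z (E.2 i).1) (z (E.2 i).2) :=
        Finset.sum_le_sum fun i hi =>
          hF.dist_le_mul _ (hS (hE.1 i hi).1) _ (hS (hE.1 i hi).2)
    _ = K * ∑ i ∈ Finset.range E.1, dist (z (E.2 i).1) (z (E.2 i).2) := by
        rw [Finset.mul_sum]
    _ ≤ K * (ε / (K + 1)) := by gcongr; exact (h E hE hlen).le
    _ < (K + 1) * (ε / (K + 1)) := by gcongr; linarith
    _ = ε := by field

theorem ContDiffOn.comp_absolutelyContinuousOnInterval {E F : Type*} [NormedAddCommGroup E]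
    [NormedSpace ℝ E] [NormedAddCommGroup F] [NormedSpace ℝ F] {f : E → F} {U : Set E}
    {z : ℝ → E} {a b : ℝ} (hf : ContDiffOn ℝ 1 f U) (hU : IsOpen U)
    (hz : AbsolutelyContinuousOnInterval z a b) (hzU : MapsTo z (uIcc a b) U) :
    AbsolutelyContinuousOnInterval (fun t => f (z t)) a b := by
  have hloc : LocallyLipschitzOn (z '' uIcc a b) f := by
    rintro _ ⟨t, ht, rfl⟩
    obtain ⟨K, W, hW, hK⟩ :=
      (hf.contDiffAt (hU.mem_nhds (hzU ht))).exists_lipschitzOnWith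
    exact ⟨K, W, mem_nhdsWithin_of_mem_nhds hW, hK⟩
  obtain ⟨K, hK⟩ := hloc.exists_lipschitzOnWith_of_compact (isCompact_uIcc.image_of_continuousOn
    hz.continuousOn)
  exact hK.comp_absolutelyContinuousOnInterval hz (mapsTo_image z _)

theorem AbsolutelyContinuousOnInterval.le_add_of_hasDerivAt_le {f : ℝ → ℝ} {a b C : ℝ}
    (hf : AbsolutelyContinuousOnInterval f a b) (hab : a ≤ b)
    (h : ∀ᵐ t, t ∈ Icc a b → ∃ v, HasDerivAt f v t ∧ v ≤ C) : f b ≤ f a + C * (b - a) := by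
  have hint := intervalIntegral.integral_mono_ae_restrict (g := fun _ => C) hab
    hf.intervalIntegrable_deriv intervalIntegrable_const (by
      refine (ae_restrict_iff' measurableSet_Icc).2 ?_
      filter_upwards [h] with t ht htI
      obtain ⟨v, hv, hvC⟩ := ht htI
      exact hv.deriv.le.trans hvC)
  rw [hf.integral_deriv_eq_sub] at hint
  simp only [intervalIntegral.integral_const, smul_eq_mul] at hint
  linarith

/-- If `w = V ∘ z` satisfies `w' ≤ C w ^ (1 - s)` almost everywhere and `z` avoids the origin, then
`w ^ s` has slope at most `s C`. -/
theorem rpow_comp_le_add {E : Type*} [NormedAddCommGroup E] [NormedSpace ℝ E] {V : E → ℝ}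
    {z : ℝ → E} {a b s C : ℝ} (hV : ContDiffOn ℝ 1 V {0}ᶜ) (hpos : ∀ x, x ≠ 0 → 0 < V x)
    (hs : 0 < s) (hz : AbsolutelyContinuousOnInterval z a b) (hab : a ≤ b)
    (hz0 : ∀ t ∈ Icc a b, z t ≠ 0)
    (h : ∀ᵐ t, t ∈ Icc a b →
      ∃ v, HasDerivAt (fun t => V (z t)) v t ∧ v ≤ C * V (z t) ^ (1 - s)) :
    V (z b) ^ s ≤ V (z a) ^ s + s * C * (b - a) := by
  have hVs : ContDiffOn ℝ 1 (fun x => V x ^ s) {0}ᶜ :=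
    hV.rpow_const_of_ne fun x hx => (hpos x hx).ne'
  have hAC : AbsolutelyContinuousOnInterval (fun t => V (z t) ^ s) a b :=
    hVs.comp_absolutelyContinuousOnInterval isOpen_compl_singleton hz
      (by rw [uIcc_of_le hab]; exact hz0)
  refine hAC.le_add_of_hasDerivAt_le hab ?_
  filter_upwards [h] with t ht htI
  obtain ⟨v, hv, hvC⟩ := ht htI
  have hw : 0 < V (z t) := hpos _ (hz0 t htI)
  refine ⟨_, hv.rpow_const (Or.inl hw.ne'), ?_⟩
  calc v * s * V (z t) ^ (s - 1) ≤ C * V (z t) ^ (1 - s) * s * V (z t) ^ (s - 1) := by gcongr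
    _ = s * C * (V (z t) ^ (1 - s) * V (z t) ^ (s - 1)) := by ring
    _ = s * C := by rw [← Real.rpow_add hw]; simp

/-- The last time a continuous function leaves the level `m`. -/
theorem exists_last_level {f : ℝ → ℝ} {a b m : ℝ} (hf : ContinuousOn f (Icc a b)) (hab : a ≤ b)
    (ha : f a ≤ m) (hb : m ≤ f b) : ∃ s ∈ Icc a b, f s = m ∧ ∀ t ∈ Icc s b, m ≤ f t := by
  have hc : IsCompact (Icc a b ∩ f ⁻¹' {m}) :=
    isCompact_Icc.of_isClosed_subset (hf.preimage_isClosed_of_isClosed isClosed_Icc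
      isClosed_singleton) inter_subset_left
  obtain ⟨t, ht, htm⟩ := intermediate_value_Icc hab hf ⟨ha, hb⟩
  obtain ⟨s, ⟨hsI, hsm⟩, hmax⟩ := hc.exists_isGreatest ⟨t, ht, htm⟩
  refine ⟨s, hsI, hsm, fun t ht => ?_⟩
  by_contra! hlt
  obtain ⟨t', ht', htm'⟩ := intermediate_value_Icc ht.2
    (hf.mono (Icc_subset_Icc (hsI.1.trans ht.1) le_rfl)) ⟨hlt.le, hb⟩
  have hle : t' ≤ s := hmax ⟨⟨hsI.1.trans (ht.1.trans ht'.1), ht'.2⟩, htm'⟩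
  have hts : t = s := le_antisymm (ht'.1.trans hle) ht.1
  rw [hts] at hlt
  exact hlt.ne hsm

/-- Growth estimate for `w' ≤ C w ^ (1 - s)`. The inequality is only assumed off the origin, so the
estimate is propagated from the last time at which `w` leaves a small positive level. -/
theorem rpow_comp_le_add_of_nonneg {E : Type*} [NormedAddCommGroup E] [NormedSpace ℝ E]
    {V : E → ℝ} {z : ℝ → E} {a b s C : ℝ} (hV : ContDiffOn ℝ 1 V {0}ᶜ) (hcont : Continuous V)
    (h0 : V 0 = 0) (hpos : ∀ x, x ≠ 0 → 0 < V x) (hs : 0 < s) (hC : 0 ≤ C)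
    (hz : AbsolutelyContinuousOnInterval z a b) (hab : a ≤ b)
    (h : ∀ᵐ t, t ∈ Icc a b → z t ≠ 0 →
      ∃ v, HasDerivAt (fun t => V (z t)) v t ∧ v ≤ C * V (z t) ^ (1 - s)) :
    V (z b) ^ s ≤ V (z a) ^ s + s * C * (b - a) := by
  have hnn : ∀ x, 0 ≤ V x := fun x => by
    rcases eq_or_ne x 0 with rfl | hx
    exacts [h0.ge, (hpos x hx).le]
  have key : ∀ m : ℝ, 0 < m → V (z b) ^ s ≤ (max m (V (z a))) ^ s + s * C * (b - a) := by
    intro m hm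
    set M := max m (V (z a))
    have hM : 0 < M := lt_max_of_lt_left hm
    rcases le_total (V (z b)) M with hle | hle
    · have := Real.rpow_le_rpow (hnn _) hle hs.le
      have : 0 ≤ s * C * (b - a) := by have := sub_nonneg.2 hab; positivity
      linarith
    have hwc : ContinuousOn (fun t => V (z t)) (Icc a b) := by
      rw [← uIcc_of_le hab]; exact hcont.comp_continuousOn hz.continuousOn
    obtain ⟨t₀, ht₀, hlev, hge⟩ := exists_last_level hwc hab (le_max_right _ _) hle
    have hsub : Icc t₀ b ⊆ Icc a b := Icc_subset_Icc ht₀.1 le_rfl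
    have hne : ∀ t ∈ Icc t₀ b, z t ≠ 0 := fun t ht hzt => by
      have := hge t ht
      simp only [hzt, h0] at this
      linarith
    have := rpow_comp_le_add (s := s) (C := C) hV hpos hs
      (hz.mono (by rw [uIcc_of_le ht₀.2, uIcc_of_le hab]; exact hsub)) ht₀.2 hne (by
        filter_upwards [h] with t ht htI using ht (hsub htI) (hne t htI))
    rw [hlev] at this
    have hmono : s * C * (b - t₀) ≤ s * C * (b - a) := by
      have := ht₀.1
      gcongr
    linarith
  have hlim : Tendsto (fun m : ℝ => (max m (V (z a))) ^ s + s * C * (b - a)) (𝓝[>] 0)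
      (𝓝 (V (z a) ^ s + s * C * (b - a))) := by
    have hc : Continuous fun m : ℝ => (max m (V (z a))) ^ s + s * C * (b - a) :=
      ((continuous_id.max continuous_const).rpow_const fun _ => Or.inr hs.le).add continuous_const
    have := hc.tendsto 0
    rw [max_eq_right (hnn _)] at this
    exact this.mono_left nhdsWithin_le_nhds
  exact ge_of_tendsto hlim (eventually_mem_nhdsWithin.mono key)

/-! ### The adaptive gain and the derivative of `V` along the closed-loop field -/

theorem adaptiveGain_eq_div {ε t : ℝ} (hε : 0 < ε) (ht : 0 ≤ t) (x : ℝ) :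
    adaptiveGain ε t x = t * ε / max ε (t * (ε - x)) := by
  unfold adaptiveGain
  split_ifs with h
  · have hx : 0 < ε - x := sub_pos.2 h
    rcases le_total (t * (ε - x)) ε with h' | h'
    · rw [max_eq_left h', min_eq_left ((le_div_iff₀ hx).2 h')]
      field
    · have htp : 0 < t := by
        by_contra! hle
        have := mul_nonpos_of_nonpos_of_nonneg hle hx.le
        linarith
      rw [max_eq_right h', min_eq_right ((div_le_iff₀ hx).2 h')]
      field
  · have : t * (ε - x) ≤ 0 := mul_nonpos_of_nonneg_of_nonpos ht (by linarith)
    rw [max_eq_left (by linarith)]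
    field

theorem continuous_adaptiveGain {ε t : ℝ} (hε : 0 < ε) (ht : 0 ≤ t) :
    Continuous (adaptiveGain ε t) := by
  rw [funext (adaptiveGain_eq_div hε ht)]
  exact continuous_const.div (by fun_prop) fun x => (lt_max_of_lt_left hε).ne'

theorem adaptiveGain_nonneg {ε t : ℝ} (hε : 0 < ε) (ht : 0 ≤ t) (x : ℝ) :
    0 ≤ adaptiveGain ε t x := by
  rw [adaptiveGain_eq_div hε ht]
  have : 0 < max ε (t * (ε - x)) := lt_max_of_lt_left hε
  positivity

theorem adaptiveGain_le (ε t x : ℝ) : adaptiveGain ε t x ≤ t := by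
  unfold adaptiveGain
  split_ifs
  exacts [min_le_left _ _, le_rfl]

/-- From time `Φ` on, the gain is at least `Φ` in a neighbourhood of `{V ≥ ε}`. -/
theorem le_adaptiveGain {ε t x Φ : ℝ} (hΦ : 0 < Φ) (ht : Φ ≤ t)
    (hx : ε - ε / Φ ≤ x) : Φ ≤ adaptiveGain ε t x := by
  unfold adaptiveGain
  split_ifs with h
  · refine le_min ht ((le_div_iff₀ (sub_pos.2 h)).2 ?_)
    calc Φ * (ε - x) ≤ Φ * (ε / Φ) := by gcongr; linarith
      _ = ε := by field
  · exact ht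

/-- `hMin` is a lower bound: the set of values is bounded below because `g` is unbounded, so that
its `sInf` is the true infimum. -/
theorem hMin_le {g : ℝ → ℝ} (hg : IsGainFunction g) {γm : ℝ} (hγm : 0 < γm) {x : ℝ}
    (hx : 0 ≤ x) : hMin g γm ≤ (γm * g x - 1) * x := by
  refine (min_le_right _ _).trans (csInf_le ?_ ⟨x, hx, rfl⟩)
  obtain ⟨X, hX⟩ := eventually_atTop.1 (hg.tendsto.eventually_ge_atTop (1 / γm))
  refine ⟨-max X 0, ?_⟩
  rintro _ ⟨y, hy, rfl⟩
  have hy : 0 ≤ y := hy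
  have hm := le_max_left X 0
  have hm0 := le_max_right X 0
  simp only
  rcases le_total X y with h | h
  · have h1 : 1 ≤ γm * g y := by
      have := hX y h
      rwa [div_le_iff₀' hγm] at this
    have : 0 ≤ (γm * g y - 1) * y := mul_nonneg (by linarith) hy
    linarith
  · have : 0 ≤ γm * g y * y := by have := hg.pos y hy; positivity
    linarith

theorem hMin_nonpos (g : ℝ → ℝ) (γm : ℝ) : hMin g γm ≤ 0 := min_le_left _ _

theorem abs_le_one_of_mem_sgnSet {x s : ℝ} (h : s ∈ sgnSet x) : |s| ≤ 1 := by
  unfold sgnSet at h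
  split_ifs at h with hx
  · exact abs_le.2 h
  · rw [mem_singleton_iff.1 h, abs_div, abs_abs, div_self (abs_ne_zero.2 hx)]

theorem chainField_eq_add {r : ℕ} (z : Fin r → ℝ) (s s' : ℝ) :
    chainField z s = chainField z s' + (s - s') • lastVec r := by
  simp only [chainField]
  module

theorem IsHomogeneousPair.hasFDerivAt {r : ℕ} {p κ : ℝ} {u₀ V : (Fin r → ℝ) → ℝ} {d c α : ℝ}
    (h : IsHomogeneousPair p κ u₀ V d c α) {z : Fin r → ℝ} (hz : z ≠ 0) :
    HasFDerivAt V (fderiv ℝ V z) z :=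
  ((h.contDiffOn_V.contDiffAt (isOpen_compl_singleton.mem_nhds hz)).differentiableAt
    one_ne_zero).hasFDerivAt

theorem IsHomogeneousPair.continuousAt_fderiv {r : ℕ} {p κ : ℝ} {u₀ V : (Fin r → ℝ) → ℝ}
    {d c α : ℝ} (h : IsHomogeneousPair p κ u₀ V d c α) {z : Fin r → ℝ} (hz : z ≠ 0) :
    ContinuousAt (fderiv ℝ V) z :=
  (h.contDiffOn_V.contDiffAt (isOpen_compl_singleton.mem_nhds hz)).continuousAt_fderiv one_ne_zero

/-- The decay estimate at a point, for the values of the feedback before convexification. Since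
`u₀` and `∂_r V` have opposite signs, the robust part of the feedback only helps. -/
theorem fderiv_chainField_le_of_mem_controlSet {r : ℕ} {p κ : ℝ} {u₀ V : (Fin r → ℝ) → ℝ}
    {d c α : ℝ} (hpair : IsHomogeneousPair p κ u₀ V d c α) {g : ℝ → ℝ} (hg : IsGainFunction g)
    {k ε φb γm : ℝ} (hk : 0 < k) (hε : 0 < ε) (hγm : 0 < γm) {t : ℝ} (ht : 0 ≤ t)
    {a b : ℝ} (ha : |a| ≤ φb) (hb : γm ≤ b) {y : Fin r → ℝ} (hy : y ≠ 0) {v : ℝ}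
    (hv : v ∈ controlSet u₀ V g k ε t y) :
    fderiv ℝ V y (chainField y (a + b * v)) ≤ -c * V y ^ α +
      |partialLast V y| * (φb - hMin g γm - k * γm * adaptiveGain ε t (V y)) := by
  obtain ⟨s, hs, rfl⟩ := hv
  set A := adaptiveGain ε t (V y)
  have hA : 0 ≤ A := adaptiveGain_nonneg hε ht _
  set D := partialLast V y with hD
  have hdec := hpair.decay y hy
  rw [chainField_eq_add y _ (u₀ y), map_add, map_smul, smul_eq_mul]
  change _ + _ * D ≤ _
  suffices (a + b * (g |u₀ y| * u₀ y + k * s * A) - u₀ y) * D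
      ≤ |D| * (φb - hMin g γm - k * γm * A) by linarith
  rcases eq_or_ne D 0 with h0 | h0
  · simp [h0]
  have hu : u₀ y ≠ 0 := fun h => h0 (hpair.partial_eq_zero y hy h)
  rw [sgnSet, if_neg hu, mem_singleton_iff] at hs
  have hsgn := hpair.sign_nonpos y hy
  have hx : 0 < |u₀ y| := abs_pos.2 hu
  have hus : u₀ y = s * |u₀ y| := by rw [hs]; field
  have hsD : s * D = -|D| := by
    have h1 : |s| = 1 := by rw [hs, abs_div, abs_abs, div_self hx.ne']
    have h2 : s * D ≤ 0 := by
      have : |u₀ y| * (s * D) ≤ 0 := by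
        calc |u₀ y| * (s * D) = (s * |u₀ y|) * D := by ring
          _ ≤ 0 := by rw [← hus]; exact hsgn
      exact nonpos_of_mul_nonpos_right this hx
    have h3 := abs_of_nonpos h2
    rw [abs_mul, h1, one_mul] at h3
    linarith
  have haD : a * D ≤ φb * |D| := (le_abs_self _).trans (by rw [abs_mul]; gcongr)
  have hgx : 0 < g |u₀ y| := hg.pos _ hx.le
  have hmin := hMin_le hg hγm hx.le
  have hlow : hMin g γm + k * γm * A ≤ (b * g |u₀ y| - 1) * |u₀ y| + k * b * A := by
    have h1 : (γm * g |u₀ y| - 1) * |u₀ y| ≤ (b * g |u₀ y| - 1) * |u₀ y| := by gcongr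
    have h2 : k * γm * A ≤ k * b * A := by gcongr
    linarith
  have hexp : (a + b * (g |u₀ y| * u₀ y + k * s * A) - u₀ y) * D
      = a * D + ((b * g |u₀ y| - 1) * |u₀ y| + k * b * A) * (s * D) := by
    have : (a + b * (g |u₀ y| * u₀ y + k * s * A) - u₀ y)
        = a + ((b * g |u₀ y| - 1) * |u₀ y| + k * b * A) * s := by
      linear_combination (b * g |u₀ y| - 1) * hus
    rw [this]; ring
  rw [hexp, hsD]
  have := mul_le_mul_of_nonneg_right hlow (abs_nonneg D)
  linarith

/-- The values of the feedback are bounded near every point. -/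
theorem exists_abs_le_of_mem_controlSet {r : ℕ} {p κ : ℝ} {u₀ V : (Fin r → ℝ) → ℝ}
    {d c α : ℝ} (hpair : IsHomogeneousPair p κ u₀ V d c α) {g : ℝ → ℝ} (hg : IsGainFunction g)
    {k ε : ℝ} (hk : 0 < k) (hε : 0 < ε) {t : ℝ} (ht : 0 ≤ t) (z : Fin r → ℝ) :
    ∃ B : ℝ, 0 < B ∧ ∀ y ∈ Metric.ball z 1, ∀ v ∈ controlSet u₀ V g k ε t y, |v| ≤ B := by
  obtain ⟨M, hM⟩ := hpair.locallyBounded (‖z‖ + 1)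
  have hM0 : 0 ≤ M := (abs_nonneg _).trans (hM z (by linarith))
  have hgM := hg.pos M hM0
  refine ⟨g M * M + k * t + 1, by positivity, ?_⟩
  rintro y hy _ ⟨s, hs, rfl⟩
  have hyn : ‖y‖ ≤ ‖z‖ + 1 := by
    have h1 := norm_le_norm_add_norm_sub' y z
    rw [Metric.mem_ball, dist_eq_norm] at hy
    linarith
  have hu := hM y hyn
  have hgu := hg.pos _ (abs_nonneg (u₀ y))
  have hA := adaptiveGain_nonneg hε ht (V y)
  have h1 : |g |u₀ y| * u₀ y| ≤ g M * M := by
    rw [abs_mul, abs_of_pos hgu]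
    gcongr
    exact hg.mono (abs_nonneg (u₀ y)) hM0 hu
  have h2 : |k * s * adaptiveGain ε t (V y)| ≤ k * t := by
    rw [abs_mul, abs_mul, abs_of_pos hk, abs_of_nonneg hA]
    calc k * |s| * adaptiveGain ε t (V y) ≤ k * 1 * t := by
          gcongr
          exacts [abs_le_one_of_mem_sgnSet hs, adaptiveGain_le _ _ _]
      _ = k * t := by ring
  have := abs_add_le (g |u₀ y| * u₀ y) (k * s * adaptiveGain ε t (V y))
  linarith

/-- The decay estimate survives the convexification. Its right-hand side is continuous in the
state, and for a fixed state it cuts out a closed half-line of inputs, which is convex. -/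
theorem fderiv_chainField_le_of_mem_filippovControl {r : ℕ} {p κ : ℝ}
    {u₀ V : (Fin r → ℝ) → ℝ} {d c α : ℝ} (hpair : IsHomogeneousPair p κ u₀ V d c α)
    {g : ℝ → ℝ} (hg : IsGainFunction g) {k ε φb γm : ℝ} (hk : 0 < k) (hε : 0 < ε)
    (hγm : 0 < γm) {t : ℝ} (ht : 0 ≤ t) {a b : ℝ} (ha : |a| ≤ φb) (hb : γm ≤ b)
    {z : Fin r → ℝ} (hz : z ≠ 0) {u : ℝ} (hu : u ∈ filippovControl u₀ V g k ε t z) :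
    fderiv ℝ V z (chainField z (a + b * u)) ≤ -c * V z ^ α +
      |partialLast V z| * (φb - hMin g γm - k * γm * adaptiveGain ε t (V z)) := by
  set R : (Fin r → ℝ) → ℝ := fun y => -c * V y ^ α +
    |partialLast V y| * (φb - hMin g γm - k * γm * adaptiveGain ε t (V y)) with hR
  set P : (Fin r → ℝ) → ℝ := fun y => fderiv ℝ V y (chainField y a) with hP
  set Q : (Fin r → ℝ) → ℝ := fun y => partialLast V y * b with hQ
  have hsplit : ∀ y v, fderiv ℝ V y (chainField y (a + b * v)) = P y + Q y * v := by
    intro y v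
    rw [chainField_eq_add y _ a, map_add, map_smul, smul_eq_mul]
    change _ + _ * partialLast V y = _
    simp only [hP, hQ]
    ring
  have hDc := hpair.continuousAt_fderiv hz
  have hpart : ContinuousAt (partialLast V) z := hDc.clm_apply continuousAt_const
  have hfield : Continuous fun y : Fin r → ℝ => chainField y a := by
    unfold chainField
    exact (Continuous.matrix_mulVec continuous_const continuous_id).add continuous_const
  have hPc : ContinuousAt P z := hDc.clm_apply hfield.continuousAt
  have hQc : ContinuousAt Q z := hpart.mul continuousAt_const
  have hRc : ContinuousAt R z := by
    have hVα : ContinuousAt (fun y => V y ^ α) z :=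
      hpair.continuous_V.continuousAt.rpow_const (Or.inl (hpair.V_pos z hz).ne')
    have hA : ContinuousAt (fun y => adaptiveGain ε t (V y)) z :=
      ((continuous_adaptiveGain hε ht).comp hpair.continuous_V).continuousAt
    exact (continuousAt_const.mul hVα).add
      (hpart.abs.mul (continuousAt_const.sub (continuousAt_const.mul hA)))
  obtain ⟨B, hB, hBv⟩ := exists_abs_le_of_mem_controlSet hpair hg hk hε ht z
  change _ ≤ R z
  rw [hsplit]
  refine le_of_forall_pos_le_add fun η hη => ?_
  have e1 : ∀ᶠ y in 𝓝 z, P z < P y + η / 3 := by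
    filter_upwards [hPc.eventually_const_lt (sub_lt_self (P z) (by positivity : 0 < η / 3))]
      with y hy using by linarith
  have e2 : ∀ᶠ y in 𝓝 z, |Q z - Q y| < η / 3 / B := by
    have hcont : ContinuousAt (fun y => |Q z - Q y|) z := (continuousAt_const.sub hQc).abs
    refine hcont.eventually_lt_const ?_
    simp only [sub_self, abs_zero]
    positivity
  have e3 : ∀ᶠ y in 𝓝 z, R y < R z + η / 3 :=
    hRc.eventually_lt_const (by linarith)
  have e4 : ∀ᶠ y in 𝓝 z, y ≠ 0 := isOpen_compl_singleton.mem_nhds hz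
  obtain ⟨δ, hδ, hball⟩ := Metric.mem_nhds_iff.1
    (e1.and (e2.and (e3.and (e4.and (Metric.ball_mem_nhds z one_pos)))))
  have hmem := mem_iInter₂.1 hu δ hδ
  have hconv : Convex ℝ {v : ℝ | Q z * v ≤ R z + η - P z} :=
    convex_halfSpace_le (LinearMap.mul ℝ ℝ (Q z)).isLinear _
  have hclosed : IsClosed {v : ℝ | Q z * v ≤ R z + η - P z} :=
    isClosed_le (by fun_prop) continuous_const
  have hsub : (⋃ y ∈ Metric.ball z δ, controlSet u₀ V g k ε t y)
      ⊆ {v : ℝ | Q z * v ≤ R z + η - P z} := by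
    intro v hv
    obtain ⟨y, hy, hvy⟩ := mem_iUnion₂.1 hv
    obtain ⟨h1, h2, h3, h4, h5⟩ := hball hy
    have hest := fderiv_chainField_le_of_mem_controlSet hpair hg hk hε hγm ht ha hb h4 hvy
    rw [hsplit] at hest
    have hQv : (Q z - Q y) * v ≤ η / 3 := by
      calc (Q z - Q y) * v ≤ |Q z - Q y| * |v| := by rw [← abs_mul]; exact le_abs_self _
        _ ≤ η / 3 / B * B := by
          gcongr
          exact hBv y h5 v hvy
        _ = η / 3 := by field
    change Q z * v ≤ _
    have hest : P y + Q y * v ≤ R y := hest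
    linarith
  have := closure_minimal (convexHull_min hsub hconv) hclosed hmem
  change Q z * u ≤ _ at this
  linarith

/-- The derivative of `V` along a trajectory, off the origin. -/
theorem IsTrajectory.ae_hasDerivAt_le {r : ℕ} {p κ : ℝ} {u₀ V : (Fin r → ℝ) → ℝ} {d c α : ℝ}
    (hpair : IsHomogeneousPair p κ u₀ V d c α) {g : ℝ → ℝ} (hg : IsGainFunction g)
    {k ε φb γm γM : ℝ} (hk : 0 < k) (hε : 0 < ε) (hγm : 0 < γm) {φ γ : ℝ → ℝ}
    {z : ℝ → Fin r → ℝ} (hunc : IsUncertainty φb γm γM φ γ)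
    (hz : IsTrajectory u₀ V g k ε φ γ z) :
    ∀ᵐ t, 0 ≤ t → z t ≠ 0 → ∃ v, HasDerivAt (fun s => V (z s)) v t ∧
      v ≤ -c * V (z t) ^ α + |partialLast V (z t)| *
        (φb - hMin g γm - k * γm * adaptiveGain ε t (V (z t))) := by
  have h1 := (ae_restrict_iff' measurableSet_Ici).1 hunc.bound_φ
  have h2 := (ae_restrict_iff' measurableSet_Ici).1 hunc.bound_γ
  have h3 := (ae_restrict_iff' measurableSet_Ici).1 hz.inclusion
  filter_upwards [h1, h2, h3] with t h1 h2 h3 ht hzt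
  obtain ⟨u, hu, hder⟩ := h3 ht
  exact ⟨_, (hpair.hasFDerivAt hzt).comp_hasDerivAt t hder,
    fderiv_chainField_le_of_mem_filippovControl hpair hg hk hε hγm ht (h1 ht) (h2 ht).1 hzt hu⟩

/-! ### Consequences of homogeneity -/

theorem weight_pos {p κ : ℝ} (hκ : κ < 0) {r i : ℕ} (h : 0 ≤ weight p κ (r + 2))
    (hi : i < r + 2) : 0 < weight p κ i := by
  have hi' : (i : ℝ) < (r : ℝ) + 2 := by exact_mod_cast hi
  unfold weight at h ⊢
  push_cast at h
  nlinarith [mul_pos_of_neg_of_neg hκ (sub_neg.2 hi')]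

theorem continuous_dilation {r : ℕ} {p κ : ℝ} (hw : ∀ i ≤ r, 0 < weight p κ i)
    (z : Fin r → ℝ) : Continuous fun l : ℝ => dilation p κ l z :=
  continuous_pi fun i => (Real.continuous_rpow_const (hw _ i.2).le).mul continuous_const

theorem dilation_zero_left {r : ℕ} {p κ : ℝ} (hw : ∀ i ≤ r, 0 < weight p κ i)
    (z : Fin r → ℝ) : dilation p κ 0 z = 0 := by
  ext i
  simp [dilation, Real.zero_rpow (hw _ i.2).ne']

/-- Every nonzero vector is carried to the unit sphere by a dilation. -/
theorem exists_norm_dilation_eq_one {r : ℕ} {p κ : ℝ} (hw : ∀ i ≤ r, 0 < weight p κ i)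
    {z : Fin r → ℝ} (hz : z ≠ 0) : ∃ l : ℝ, 0 < l ∧ ‖dilation p κ l z‖ = 1 := by
  obtain ⟨i, hi⟩ := Function.ne_iff.1 hz
  have hzi : 0 < |z i| := abs_pos.2 hi
  have hwi := hw _ i.2
  set L : ℝ := (1 / |z i|) ^ (weight p κ (i.val + 1))⁻¹
  have hL : 0 ≤ L := by positivity
  have h1 : 1 ≤ ‖dilation p κ L z‖ := by
    have h := norm_le_pi_norm (dilation p κ L z) i
    refine le_trans (le_of_eq ?_) h
    rw [dilation, norm_mul, Real.norm_eq_abs, Real.norm_eq_abs,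
      Real.rpow_inv_rpow (by positivity) hwi.ne', abs_of_pos (by positivity)]
    field
  obtain ⟨l, hl, hl1⟩ := intermediate_value_Icc hL
    (continuous_dilation hw z).norm.continuousOn ⟨by simp [dilation_zero_left hw], h1⟩
  simp only at hl1
  refine ⟨l, lt_of_le_of_ne hl.1 ?_, hl1⟩
  rintro rfl
  simp [dilation_zero_left hw] at hl1

theorem dilation_lastVec {r : ℕ} (p κ l : ℝ) :
    dilation p κ l (lastVec r) = l ^ weight p κ r • lastVec r := by
  ext i
  simp only [dilation, lastVec, Pi.smul_apply, smul_eq_mul]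
  split_ifs with h
  · rw [h]
  · simp

theorem dilation_ne_zero {r : ℕ} {p κ l : ℝ} (hl : 0 < l) {z : Fin r → ℝ} (hz : z ≠ 0) :
    dilation p κ l z ≠ 0 := by
  obtain ⟨i, hi⟩ := Function.ne_iff.1 hz
  exact Function.ne_iff.2 ⟨i, mul_ne_zero (Real.rpow_pos_of_pos hl _).ne' hi⟩

namespace IsHomogeneousPair

variable {r : ℕ} {p κ : ℝ} {u₀ V : (Fin r → ℝ) → ℝ} {d c α : ℝ}

theorem V_nonneg (h : IsHomogeneousPair p κ u₀ V d c α) (z : Fin r → ℝ) : 0 ≤ V z := by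
  rcases eq_or_ne z 0 with rfl | hz
  exacts [h.V_zero.ge, (h.V_pos z hz).le]

theorem fderiv_dilation (h : IsHomogeneousPair p κ u₀ V d c α) {l : ℝ} (hl : 0 < l)
    {z : Fin r → ℝ} (hz : z ≠ 0) (w : Fin r → ℝ) :
    fderiv ℝ V (dilation p κ l z) (dilation p κ l w) = l ^ d * fderiv ℝ V z w := by
  let D : (Fin r → ℝ) →L[ℝ] (Fin r → ℝ) := ContinuousLinearMap.pi fun i =>
    l ^ weight p κ (i.val + 1) • ContinuousLinearMap.proj (R := ℝ) (φ := fun _ : Fin r => ℝ) i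
  have hD : ∀ x, D x = dilation p κ l x := fun x => rfl
  have h1 : HasFDerivAt (fun x => V (D x)) ((fderiv ℝ V (D z)).comp D) z :=
    (h.hasFDerivAt (z := D z) (by rw [hD]; exact dilation_ne_zero hl hz)).comp z D.hasFDerivAt
  have h2 : HasFDerivAt (fun x => V (D x)) (l ^ d • fderiv ℝ V z) z := by
    simp only [hD, h.V_homogeneous l hl]
    exact (h.hasFDerivAt hz).const_mul _
  exact DFunLike.congr_fun (h1.unique h2) w

theorem partialLast_dilation (h : IsHomogeneousPair p κ u₀ V d c α) {l : ℝ} (hl : 0 < l)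
    {z : Fin r → ℝ} (hz : z ≠ 0) :
    l ^ weight p κ r * partialLast V (dilation p κ l z) = l ^ d * partialLast V z := by
  rw [partialLast, partialLast, ← h.fderiv_dilation hl hz, dilation_lastVec, map_smul, smul_eq_mul]

theorem degree_pos (h : IsHomogeneousPair p κ u₀ V d c α) (hr : 0 < r)
    (hw : ∀ i ≤ r, 0 < weight p κ i) : 0 < d := by
  by_contra! hd
  set e : Fin r → ℝ := fun _ => 1
  have he : e ≠ 0 := Function.ne_iff.2 ⟨⟨0, hr⟩, by simp [e]⟩
  have hlim : Tendsto (fun l : ℝ => V (dilation p κ l e)) (𝓝[>] 0) (𝓝 0) := by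
    have := (h.continuous_V.comp (continuous_dilation hw e)).tendsto 0
    simp only [Function.comp_apply, dilation_zero_left hw, h.V_zero] at this
    exact this.mono_left nhdsWithin_le_nhds
  have hge : V e ≤ 0 := by
    refine ge_of_tendsto hlim ?_
    filter_upwards [Ioc_mem_nhdsGT (one_pos : (0 : ℝ) < 1)] with l hl
    rw [h.V_homogeneous l hl.1]
    have := Real.one_le_rpow_of_pos_of_le_one_of_nonpos hl.1 hl.2 hd
    nlinarith [h.V_pos e he]
  exact (h.V_pos e he).not_ge hge

/-- Both sides of the decay estimate are homogeneous, so their degrees `d + κ` and `d α` agree: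
otherwise a suitable dilation would violate it. -/
theorem degree_add_eq (h : IsHomogeneousPair p κ u₀ V d c α) (hr : 0 < r) : d + κ = d * α := by
  by_contra hne
  set θ := d + κ - d * α with hθ
  have hθ0 : θ ≠ 0 := sub_ne_zero.2 hne
  set e : Fin r → ℝ := fun _ => 1
  have he : e ≠ 0 := Function.ne_iff.2 ⟨⟨0, hr⟩, by simp [e]⟩
  set A := fderiv ℝ V e (chainField e (u₀ e)) with hA
  have hVe := h.V_pos e he
  have hB : 0 < c * V e ^ α := mul_pos h.c_pos (Real.rpow_pos_of_pos hVe _)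
  have key : ∀ l : ℝ, 0 < l → l ^ θ * A ≤ -(c * V e ^ α) := by
    intro l hl
    have h1 := h.decay _ (dilation_ne_zero (p := p) (κ := κ) hl he)
    rw [h.field_homogeneous l hl, map_smul, smul_eq_mul, h.fderiv_dilation hl he,
      h.V_homogeneous l hl, Real.mul_rpow (Real.rpow_nonneg hl.le _) hVe.le,
      ← Real.rpow_mul hl.le] at h1
    have h2 : l ^ θ = l ^ d * l ^ κ / l ^ (d * α) := by
      rw [hθ, Real.rpow_sub hl, Real.rpow_add hl]
    have hp : 0 < l ^ (d * α) := Real.rpow_pos_of_pos hl _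
    rw [h2, div_mul_eq_mul_div, div_le_iff₀ hp]
    linarith
  have hx : 0 < c * V e ^ α / (2 * (|A| + 1)) := by positivity
  have h1 := key ((c * V e ^ α / (2 * (|A| + 1))) ^ θ⁻¹) (Real.rpow_pos_of_pos hx _)
  rw [Real.rpow_inv_rpow hx.le hθ0] at h1
  have h2 : c * V e ^ α / (2 * (|A| + 1)) * -A ≤ c * V e ^ α / (2 * (|A| + 1)) * (|A| + 1) := by
    gcongr
    linarith [neg_le_abs A]
  have h3 : c * V e ^ α / (2 * (|A| + 1)) * (|A| + 1) = c * V e ^ α / 2 := by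
    field
  linarith

/-- The last partial derivative has degree `d - p_r`, hence is dominated by the power of `V` of the
same degree. -/
theorem exists_abs_partialLast_le (h : IsHomogeneousPair p κ u₀ V d c α) (hd : 0 < d)
    (hw : ∀ i ≤ r, 0 < weight p κ i) :
    ∃ C : ℝ, 0 < C ∧ ∀ z, z ≠ 0 → |partialLast V z| ≤ C * V z ^ (1 - weight p κ r / d) := by
  have hne : ∀ y ∈ Metric.sphere (0 : Fin r → ℝ) 1, y ≠ 0 := by
    rintro y hy rfl
    simp at hy
  have hcont : ContinuousOn (fun y => partialLast V y / V y ^ (1 - weight p κ r / d))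
      (Metric.sphere 0 1) := by
    intro y hy
    have hy0 := hne y hy
    have hVy := h.V_pos y hy0
    have hD : ContinuousAt (partialLast V) y :=
      (h.continuousAt_fderiv hy0).clm_apply continuousAt_const
    exact (hD.div (h.continuous_V.continuousAt.rpow_const (Or.inl hVy.ne'))
      (Real.rpow_pos_of_pos hVy _).ne').continuousWithinAt
  obtain ⟨C, hC⟩ := (isCompact_sphere (0 : Fin r → ℝ) 1).exists_bound_of_continuousOn hcont
  refine ⟨max C 1, by positivity, fun z hz => ?_⟩
  obtain ⟨l, hl, hnorm⟩ := exists_norm_dilation_eq_one hw hz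
  have hz' := dilation_ne_zero (p := p) (κ := κ) hl hz
  have hVz := h.V_pos z hz
  have hb := hC (dilation p κ l z) (by simpa using hnorm)
  rw [norm_div, Real.norm_eq_abs, Real.norm_eq_abs,
    abs_of_pos (Real.rpow_pos_of_pos (h.V_pos _ hz') _),
    div_le_iff₀ (Real.rpow_pos_of_pos (h.V_pos _ hz') _), h.V_homogeneous l hl,
    Real.mul_rpow (Real.rpow_nonneg hl.le _) hVz.le, ← Real.rpow_mul hl.le] at hb
  have hexp : d * (1 - weight p κ r / d) = d - weight p κ r := by field
  rw [hexp, Real.rpow_sub hl] at hb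
  have hpw : 0 < l ^ weight p κ r := Real.rpow_pos_of_pos hl _
  have hpd : 0 < l ^ d := Real.rpow_pos_of_pos hl _
  have heq := congrArg abs (h.partialLast_dilation hl hz)
  rw [abs_mul, abs_mul, abs_of_pos hpw, abs_of_pos hpd] at heq
  have hlow : |partialLast V z| ≤ C * V z ^ (1 - weight p κ r / d) := by
    refine le_of_mul_le_mul_left ?_ hpd
    rw [← heq]
    calc l ^ weight p κ r * |partialLast V (dilation p κ l z)|
        ≤ l ^ weight p κ r *
          (C * (l ^ d / l ^ weight p κ r * V z ^ (1 - weight p κ r / d))) := by gcongr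
      _ = l ^ d * (C * V z ^ (1 - weight p κ r / d)) := by field
  refine hlow.trans ?_
  have := Real.rpow_pos_of_pos hVz (1 - weight p κ r / d)
  gcongr
  exact le_max_left _ _

end IsHomogeneousPair

/-! ### Comparison of the time bounds for different exponents -/

/-- For large `v` the increment of `(v ^ β + K) ^ (e / β)` over `v ^ e` tends to `0` because
`e < β`, and is absorbed by `E`; bounded `v` are dealt with by a large constant. -/
theorem exists_rpow_add_lt {β e s K E Φ : ℝ} (he : 0 < e) (heβ : e < β) (hs : 0 < s)
    (hK : 0 ≤ K) (hE : 0 < E) (hΦ : 0 < Φ) :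
    ∃ C : ℝ, 0 < C ∧ ∀ v, 0 ≤ v →
      (v ^ β + K) ^ (e / β) < (v ^ s + s * C * Φ) ^ (e / s) + E := by
  have hβ : 0 < β := he.trans heβ
  have hlim : Tendsto (fun v : ℝ => K * v ^ (-(β - e))) atTop (𝓝 0) := by
    simpa using (tendsto_rpow_neg_atTop (sub_pos.2 heβ)).const_mul K
  obtain ⟨R, hR⟩ := eventually_atTop.1
    ((hlim.eventually_lt_const hE).and (eventually_gt_atTop (0 : ℝ)))
  set M : ℝ := (max R 0 ^ β + K) ^ (e / β)
  have hM : 0 ≤ M := by positivity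
  have hX : 0 < (M + 1) ^ (s / e) := by positivity
  refine ⟨(M + 1) ^ (s / e) / (s * Φ), by positivity, fun v hv => ?_⟩
  have hC : s * ((M + 1) ^ (s / e) / (s * Φ)) * Φ = (M + 1) ^ (s / e) := by field
  rw [hC]
  rcases le_total R v with h | h
  · obtain ⟨h1, hv0⟩ := hR v h
    have hvβ : 0 < v ^ β := Real.rpow_pos_of_pos hv0 _
    have hσ : e / β ≤ 1 := (div_le_one hβ).2 heβ.le
    have hpow : (v ^ β) ^ (e / β) = v ^ e := by
      rw [← Real.rpow_mul hv]; congr 1; field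
    have hle : (v ^ β + K) ^ (e / β) ≤ v ^ e + K * v ^ (-(β - e)) := by
      calc (v ^ β + K) ^ (e / β) = (v ^ β * (1 + K / v ^ β)) ^ (e / β) := by
            congr 1; field
        _ = v ^ e * (1 + K / v ^ β) ^ (e / β) := by
            rw [Real.mul_rpow hvβ.le (by positivity), hpow]
        _ ≤ v ^ e * (1 + K / v ^ β) := by
            gcongr
            have h1 : 1 ≤ 1 + K / v ^ β := le_add_of_nonneg_right (by positivity)
            simpa using Real.rpow_le_rpow_of_exponent_le h1 hσ
        _ = v ^ e + K * v ^ (-(β - e)) := by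
            rw [neg_sub, Real.rpow_sub hv0]; ring
    have hge : v ^ e ≤ (v ^ s + (M + 1) ^ (s / e)) ^ (e / s) := by
      calc v ^ e = (v ^ s) ^ (e / s) := by rw [← Real.rpow_mul hv]; congr 1; field
        _ ≤ _ := by
            gcongr
            exact le_add_of_nonneg_right hX.le
    linarith
  · have hle : (v ^ β + K) ^ (e / β) ≤ M := by
      simp only [M]
      gcongr
      exact h.trans (le_max_left _ _)
    have hge : M + 1 ≤ (v ^ s + (M + 1) ^ (s / e)) ^ (e / s) := by
      calc M + 1 = ((M + 1) ^ (s / e)) ^ (e / s) := by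
            rw [← Real.rpow_mul (by positivity), div_mul_div_cancel₀ he.ne', div_self hs.ne',
              Real.rpow_one]
        _ ≤ _ := by
            gcongr
            exact le_add_of_nonneg_left (by positivity)
    linarith

/-! ### Trajectories before and after the time `Φ` -/

theorem PhiBar_pos (g : ℝ → ℝ) {k φb γm : ℝ} (hk : 0 < k) (hγm : 0 < γm) (hφb : 0 < φb) :
    0 < PhiBar g k φb γm := by
  have := hMin_nonpos g γm
  exact mul_pos (by positivity) (by linarith)

theorem mul_PhiBar (g : ℝ → ℝ) {k φb γm : ℝ} (hk : 0 < k) (hγm : 0 < γm) :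
    k * γm * PhiBar g k φb γm = φb - hMin g γm := by
  unfold PhiBar
  field

namespace IsTrajectory

variable {r : ℕ} {p κ : ℝ} {u₀ V : (Fin r → ℝ) → ℝ} {d c α : ℝ} {g : ℝ → ℝ}
  {k ε φb γm γM : ℝ} {φ γ : ℝ → ℝ} {z : ℝ → Fin r → ℝ}

theorem absolutelyContinuousOn (hz : IsTrajectory u₀ V g k ε φ γ z) {a b : ℝ} (ha : 0 ≤ a)
    (hab : a ≤ b) : AbsolutelyContinuousOnInterval z a b :=
  (hz.absolutelyContinuous b (ha.trans hab)).mono (by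
    rw [uIcc_of_le hab, uIcc_of_le (ha.trans hab)]
    exact Icc_subset_Icc ha le_rfl)

/-- After the time `Φ` the perturbation is dominated wherever `V` is at least `ε - ε / Φ`, and `V`
decays there as along the nominal system. -/
theorem rpow_le_add_of_PhiBar_le (hpair : IsHomogeneousPair p κ u₀ V d c α)
    (hg : IsGainFunction g) (hk : 0 < k) (hε : 0 < ε) (hγm : 0 < γm) (hφb : 0 < φb)
    (hunc : IsUncertainty φb γm γM φ γ) (hz : IsTrajectory u₀ V g k ε φ γ z) {a b m : ℝ}
    (ha : PhiBar g k φb γm ≤ a) (hab : a ≤ b) (hm : 0 < m)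
    (hmε : ε - ε / PhiBar g k φb γm ≤ m) (hV : ∀ t ∈ Icc a b, m ≤ V (z t)) :
    V (z b) ^ (1 - α) ≤ V (z a) ^ (1 - α) + (1 - α) * -c * (b - a) := by
  have hΦ := PhiBar_pos g hk hγm hφb
  have hne : ∀ t ∈ Icc a b, z t ≠ 0 := fun t ht h0 => by
    have := hV t ht
    rw [h0, hpair.V_zero] at this
    linarith
  refine rpow_comp_le_add hpair.contDiffOn_V hpair.V_pos (sub_pos.2 hpair.α_mem.2)
    (hz.absolutelyContinuousOn (hΦ.le.trans ha) hab) hab hne ?_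
  filter_upwards [ae_hasDerivAt_le hpair hg hk hε hγm hunc hz] with t ht htI
  obtain ⟨v, hv, hle⟩ := ht (hΦ.le.trans (ha.trans htI.1)) (hne t htI)
  refine ⟨v, hv, hle.trans ?_⟩
  have hgain := le_adaptiveGain hΦ (ha.trans htI.1) (hmε.trans (hV t htI))
  have h1 : k * γm * PhiBar g k φb γm ≤ k * γm * adaptiveGain ε t (V (z t)) := by gcongr
  rw [mul_PhiBar g hk hγm] at h1
  have := mul_nonpos_of_nonneg_of_nonpos (abs_nonneg (partialLast V (z t))) (sub_nonpos.2 h1)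
  rw [sub_sub_cancel]
  linarith

/-- The sublevel set `{V < ε}` is forward invariant from the time `Φ` on: near its boundary `V`
already decreases. -/
theorem lt_of_lt_of_le (hpair : IsHomogeneousPair p κ u₀ V d c α)
    (hg : IsGainFunction g) (hk : 0 < k) (hε : 0 < ε) (hγm : 0 < γm) (hφb : 0 < φb)
    (hunc : IsUncertainty φb γm γM φ γ) (hz : IsTrajectory u₀ V g k ε φ γ z) {a b : ℝ}
    (ha : PhiBar g k φb γm ≤ a) (hab : a ≤ b) (hVa : V (z a) < ε) : V (z b) < ε := by
  by_contra! hb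
  have hΦ := PhiBar_pos g hk hγm hφb
  have ha0 := hΦ.le.trans ha
  -- `ε / 2` keeps the level positive when `Φ ≤ 1`.
  set m := max (V (z a)) (max (ε / 2) (ε - ε / PhiBar g k φb γm))
  have hmε : m < ε :=
    max_lt hVa (max_lt (half_lt_self hε) (sub_lt_self _ (by positivity)))
  have hm2 : ε / 2 ≤ m := (le_max_left _ _).trans (le_max_right _ _)
  have hmΦ : ε - ε / PhiBar g k φb γm ≤ m := (le_max_right _ _).trans (le_max_right _ _)
  have hwc : ContinuousOn (fun t => V (z t)) (Icc a b) := by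
    rw [← uIcc_of_le hab]
    exact hpair.continuous_V.comp_continuousOn (hz.absolutelyContinuousOn ha0 hab).continuousOn
  obtain ⟨s, hs, hsm, hge⟩ := exists_last_level hwc hab (le_max_left _ _) (hmε.le.trans hb)
  have h := rpow_le_add_of_PhiBar_le hpair hg hk hε hγm hφb hunc hz (ha.trans hs.1) hs.2
    (by linarith) hmΦ hge
  have hα := sub_pos.2 hpair.α_mem.2
  have h0 : 0 ≤ (1 - α) * c * (b - s) :=
    mul_nonneg (mul_pos hα hpair.c_pos).le (sub_nonneg.2 hs.2)
  have hlt : V (z s) ^ (1 - α) < V (z b) ^ (1 - α) := by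
    rw [hsm]
    exact Real.rpow_lt_rpow (by linarith) (hmε.trans_le hb) hα
  linarith

theorem convergenceTime_le (hpair : IsHomogeneousPair p κ u₀ V d c α)
    (hg : IsGainFunction g) (hk : 0 < k) (hε : 0 < ε) (hγm : 0 < γm) (hφb : 0 < φb)
    (hunc : IsUncertainty φb γm γM φ γ) (hz : IsTrajectory u₀ V g k ε φ γ z) {X : ℝ}
    (hX : 0 ≤ X) (hVX : V (z (PhiBar g k φb γm)) ^ (1 - α) < X + ε ^ (1 - α)) :
    convergenceTime V ε z ≤ ENNReal.ofReal (PhiBar g k φb γm + X / (c * (1 - α))) := by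
  have hΦ := PhiBar_pos g hk hγm hφb
  have hα := sub_pos.2 hpair.α_mem.2
  have hc := hpair.c_pos
  set Φ := PhiBar g k φb γm
  set T := Φ + X / (c * (1 - α)) with hT
  have hΦT : Φ ≤ T := le_add_of_nonneg_right (by positivity)
  -- Otherwise `V ≥ ε` on `[Φ, T]`, and the decay over this interval leaves nothing of `V`.
  have hVT : V (z T) < ε := by
    by_contra! hTε
    have hge : ∀ t ∈ Icc Φ T, ε ≤ V (z t) := fun t ht => by
      by_contra! hlt
      exact (lt_of_lt_of_le hpair hg hk hε hγm hφb hunc hz ht.1 ht.2 hlt).not_ge hTε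
    have h := rpow_le_add_of_PhiBar_le hpair hg hk hε hγm hφb hunc hz le_rfl hΦT hε
      (sub_le_self _ (by positivity)) hge
    have hmul : (1 - α) * -c * (T - Φ) = -X := by rw [hT]; field
    rw [hmul] at h
    have := Real.rpow_le_rpow hε.le hTε hα.le
    linarith
  refine iInf₂_le (T.toNNReal) fun t ht => ?_
  rw [Real.coe_toNNReal _ (hΦ.le.trans hΦT)] at ht
  exact lt_of_lt_of_le hpair hg hk hε hγm hφb hunc hz hΦT ht hVT

/-- Growth of `V` before the time `Φ`. -/
theorem rpow_PhiBar_le (hpair : IsHomogeneousPair p κ u₀ V d c α)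
    (hk : 0 < k) (hγm : 0 < γm) (hφb : 0 < φb)
    (hz : IsTrajectory u₀ V g k ε φ γ z) {s C : ℝ} (hs : 0 < s) (hC : 0 ≤ C)
    (h : DiffIneqAlong V c α C (1 - s) z) :
    V (z (PhiBar g k φb γm)) ^ (1 - α) ≤
      (V (z 0) ^ s + s * C * PhiBar g k φb γm) ^ ((1 - α) / s) := by
  have hΦ := PhiBar_pos g hk hγm hφb
  have hα := sub_pos.2 hpair.α_mem.2
  have hgrow := rpow_comp_le_add_of_nonneg hpair.contDiffOn_V hpair.continuous_V hpair.V_zero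
    hpair.V_pos hs hC (hz.absolutelyContinuousOn le_rfl hΦ.le) hΦ.le (by
      filter_upwards [(ae_restrict_iff' measurableSet_Ici).1 h] with t ht htI hzt
      obtain ⟨v, hv, hle⟩ := ht htI.1 hzt
      refine ⟨v, hv, hle.trans ?_⟩
      have : 0 ≤ c * V (z t) ^ α :=
        mul_nonneg hpair.c_pos.le (Real.rpow_nonneg (hpair.V_nonneg _) _)
      linarith)
  rw [sub_zero] at hgrow
  have hV := hpair.V_nonneg (z (PhiBar g k φb γm))
  calc V (z (PhiBar g k φb γm)) ^ (1 - α)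
      = (V (z (PhiBar g k φb γm)) ^ s) ^ ((1 - α) / s) := by
        rw [← Real.rpow_mul hV]; congr 1; field
    _ ≤ _ := by gcongr

/-- The differential inequality whose exponent is dictated by the degree of `V`. -/
theorem exists_diffIneqAlong (hpair : IsHomogeneousPair p κ u₀ V d c α) (hd : 0 < d)
    (hw : ∀ i ≤ r, 0 < weight p κ i) (hg : IsGainFunction g) (hk : 0 < k) (hε : 0 < ε)
    (hγm : 0 < γm) (hφb : 0 < φb) :
    ∃ C : ℝ, 0 < C ∧ ∀ (φ γ : ℝ → ℝ) (z : ℝ → Fin r → ℝ), IsUncertainty φb γm γM φ γ →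
      IsTrajectory u₀ V g k ε φ γ z → DiffIneqAlong V c α C (1 - weight p κ r / d) z := by
  obtain ⟨C, hC, hle⟩ := hpair.exists_abs_partialLast_le hd hw
  have hpos : 0 < φb - hMin g γm := by linarith [hMin_nonpos g γm]
  refine ⟨C * (φb - hMin g γm), by positivity, fun φ γ z hunc hz => ?_⟩
  refine (ae_restrict_iff' measurableSet_Ici).2 ?_
  filter_upwards [ae_hasDerivAt_le hpair hg hk hε hγm hunc hz] with t ht ht0 hzt
  obtain ⟨v, hv, hvle⟩ := ht ht0 hzt
  refine ⟨v, hv, hvle.trans ?_⟩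
  have hA : 0 ≤ k * γm * adaptiveGain ε t (V (z t)) :=
    mul_nonneg (by positivity) (adaptiveGain_nonneg hε ht0 _)
  have h1 : |partialLast V (z t)| * (φb - hMin g γm - k * γm * adaptiveGain ε t (V (z t))) ≤
      |partialLast V (z t)| * (φb - hMin g γm) :=
    mul_le_mul_of_nonneg_left (sub_le_self _ hA) (abs_nonneg _)
  have h2 := mul_le_mul_of_nonneg_right (hle _ hzt) hpos.le
  linarith

end IsTrajectory

/-! ### Bounds for the convergence time -/

theorem proposition1 {r : ℕ} (hr : 0 < r) (p κ : ℝ) (hp : 0 < p) (hκ : κ < 0)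
    (hpκ : weight p κ (r + 2) ∈ Ico (0 : ℝ) 1)
    (u₀ V : (Fin r → ℝ) → ℝ) (d c α : ℝ) (hpair : IsHomogeneousPair p κ u₀ V d c α)
    (g : ℝ → ℝ) (hg : IsGainFunction g) (k ε : ℝ) (hk : 0 < k) (hε : 0 < ε)
    (φb γm γM : ℝ) (hφb : 0 < φb) (hγm : 0 < γm) (hγM : γm ≤ γM) :
    -- the bound, for every constant `C₁` for which the differential inequality holds
    (∀ C₁ : ℝ, 0 < C₁ → ∀ (φ γ : ℝ → ℝ) (z : ℝ → Fin r → ℝ), IsUncertainty φb γm γM φ γ →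
      IsTrajectory u₀ V g k ε φ γ z → DiffIneqAlong V c α C₁ (weight p κ (r + 2)) z →
      convergenceTime V ε z ≤ ENNReal.ofReal
        (timeBound (PhiBar g k φb γm) (V (z 0)) (weight p κ (r + 2)) C₁ c α)) ∧
    -- such a `C₁`, the same for all trajectories, exists if `V` has the matching degree
    (d * (1 - weight p κ (r + 2)) = weight p κ r →
      ∃ C₁ : ℝ, 0 < C₁ ∧ ∀ (φ γ : ℝ → ℝ) (z : ℝ → Fin r → ℝ), IsUncertainty φb γm γM φ γ →
        IsTrajectory u₀ V g k ε φ γ z → DiffIneqAlong V c α C₁ (weight p κ (r + 2)) z) ∧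
    -- whatever the degree of `V`, the bound holds for some `C₁`, the same for all trajectories
    (∃ C₁ : ℝ, 0 < C₁ ∧ ∀ (φ γ : ℝ → ℝ) (z : ℝ → Fin r → ℝ), IsUncertainty φb γm γM φ γ →
      IsTrajectory u₀ V g k ε φ γ z →
      convergenceTime V ε z ≤ ENNReal.ofReal
        (timeBound (PhiBar g k φb γm) (V (z 0)) (weight p κ (r + 2)) C₁ c α)) := by
  set q := weight p κ (r + 2)
  have hs : 0 < 1 - q := sub_pos.2 hpκ.2
  have hα := sub_pos.2 hpair.α_mem.2
  have hw : ∀ i ≤ r, 0 < weight p κ i := fun i hi => weight_pos hκ hpκ.1 (by omega)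
  have hd : 0 < d := hpair.degree_pos hr hw
  have hΦ := PhiBar_pos g hk hγm hφb
  have hεα : 0 < ε ^ (1 - α) := Real.rpow_pos_of_pos hε _
  have hnn : ∀ (C₁ : ℝ) (x : Fin r → ℝ), 0 < C₁ →
      0 ≤ (V x ^ (1 - q) + (1 - q) * C₁ * PhiBar g k φb γm) ^ ((1 - α) / (1 - q)) := by
    intro C₁ x hC₁
    have := hpair.V_nonneg x
    positivity
  refine ⟨fun C₁ hC₁ φ γ z hunc hz hI => ?_, fun hdeg => ?_, ?_⟩
  · have hgrow := hz.rpow_PhiBar_le hpair hk hγm hφb hs hC₁.le (by rwa [sub_sub_cancel])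
    exact hz.convergenceTime_le hpair hg hk hε hγm hφb hunc (hnn C₁ _ hC₁) (by linarith)
  · have hq : 1 - weight p κ r / d = q := by
      rw [← hdeg]
      field
    rw [← hq]
    exact IsTrajectory.exists_diffIneqAlong hpair hd hw hg hk hε hγm hφb
  · obtain ⟨C, hC, hI⟩ := IsTrajectory.exists_diffIneqAlong (γM := γM) hpair hd hw hg hk hε hγm hφb
    -- `1 - α = -κ / d` and `p_r = q - 2 κ`, so the exponent `1 - α` is the smaller one.
    have hlt : 1 - α < weight p κ r / d := by
      have h1 := hpair.degree_add_eq hr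
      have h2 : weight p κ r = q - 2 * κ := by
        simp only [q, weight]
        push_cast
        ring
      rw [lt_div_iff₀ hd, h2]
      linarith [hpκ.1]
    have hβ := hα.trans hlt
    obtain ⟨C₁, hC₁, hcmp⟩ := exists_rpow_add_lt (K := weight p κ r / d * C * PhiBar g k φb γm)
      hα hlt hs (by positivity) hεα hΦ
    refine ⟨C₁, hC₁, fun φ γ z hunc hz => ?_⟩
    have hgrow := hz.rpow_PhiBar_le hpair hk hγm hφb hβ hC.le (hI φ γ z hunc hz)
    exact hz.convergenceTime_le hpair hg hk hε hγm hφb hunc (hnn C₁ _ hC₁)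
      (hgrow.trans_lt (hcmp _ (hpair.V_nonneg _)))
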